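/- A finite chain ring of length $2$ is a finite associative ring $R$ with identity (not necessarily commutative) whose left ideals form a chain, whose right ideals form a chain, and whose radical $J=\operatorname{rad}R$ satisfies $J\neq 0=J^2$; put $q=|R/J|$. The right projective Hjelmslev plane $\mathrm{PHG}(2,R)$ has as points and lines the free submodules of rank $1$ and of rank $2$, respectively, of the free right module $R^3_R$; incidence is inclusion. A multiset of points assigns to every point a multiplicity in $\{0,1,2,\dots\}$; it is projective if all multiplicities are $0$ or $1$. The multiplicity of a set of points is the sum of the multiplicities of its points. A $(k,n)$-arc is a multiset of points of total multiplicity $k$ such that every line has multiplicity at most $n$. Let $\mathrm{m}_n(R)$ be the largest $k$ for which a projective $(k,n)$-arc in $\mathrm{PHG}(2,R)$ exists. Theorem. Let $R$ be a finite chain ring of length $2$ with $|R/\operatorname{rad}R|=q$. In $\mathrm{PHG}(2,R)$ there exist projective $\bigl(q^3+(t+4)q^2+(t-4)q-2t,\;2q+t\bigr)$-arcs for every integer $t$ with $0\le t\le q-5$; if $q\ge 4$, a projective $(2q^3+q^2-12q+16,\;3q-4)$-arc; a projective $(2q^3+q^2-5q,\;3q-3)$-arc; and a projective $(2q^3+q^2-2q,\;3q-2)$-arc.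 Consequently, for $n=2q+t$ with $0\le t\le q-2$, \[ \mathrm{m}_n(R)\ \ge\ \begin{cases} q(q+1)n-q^3+2q^2-4q-2t & \text{if } t\le q-5,\\ q(q+1)n-q^3+2q^2-8q+16 & \text{if } t=q-4,\\ q(q+1)n-q^3+q^2-2q & \text{if } t=q-3,\\ q(q+1)n-q^3 & \text{if } t=q-2. \end{cases} \] -/

import Mathlib

/-- A finite chain ring of length (nilpotency index) two: a finite associative unital ring, not
necessarily commutative, whose left ideals form a chain, whose right ideals form a chain, and whose
Jacobson radical `J` satisfies `J ≠ 0` and `J ^ 2 = 0`. -/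
structure IsFiniteChainRingOfLengthTwo (R : Type*) [Ring R] : Prop where
  finite : Finite R
  left_chain : ∀ I J : Submodule R R, I ≤ J ∨ J ≤ I
  right_chain : ∀ I J : Submodule Rᵐᵒᵖ R, I ≤ J ∨ J ≤ I
  radical_ne_bot : Ring.jacobson R ≠ ⊥
  radical_sq : ∀ a ∈ Ring.jacobson R, ∀ b ∈ Ring.jacobson R, a * b = 0

/-- The order of the residue field of a chain ring: the cardinality of `R` modulo its radical. -/
noncomputable def residueOrder (R : Type*) [Ring R] : ℕ :=
  Nat.card (R ⧸ Ring.jacobson R)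

namespace PHG

/-- The submodule `U` of the free right `R`-module `R ^ 3` is free of rank `k`. -/
def IsFreeOfRank {R : Type*} [Ring R] (k : ℕ) (U : Submodule Rᵐᵒᵖ (Fin 3 → R)) : Prop :=
  Nonempty (Module.Basis (Fin k) Rᵐᵒᵖ U)

/-- The points of the right projective Hjelmslev plane over `R`: the free rank one submodules of
the free right `R`-module `R ^ 3`. -/
def Point (R : Type*) [Ring R] : Type _ :=
  {U : Submodule Rᵐᵒᵖ (Fin 3 → R) // IsFreeOfRank 1 U}

/-- The lines of the right projective Hjelmslev plane over `R`: the free rank two submodules of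
the free right `R`-module `R ^ 3`. -/
def Line (R : Type*) [Ring R] : Type _ :=
  {U : Submodule Rᵐᵒᵖ (Fin 3 → R) // IsFreeOfRank 2 U}

/-- The set of points incident with a line; incidence is set inclusion. -/
def Line.points {R : Type*} [Ring R] (L : Line R) : Set (Point R) :=
  {x | x.1 ≤ L.1}

/-- The multiplicity of a set of points in a multiset of points. -/
noncomputable def multiplicity {R : Type*} [Ring R] (K : Point R → ℕ) (S : Set (Point R)) : ℕ :=
  ∑ᶠ x ∈ S, K x

/-- A multiset of points is projective if all points have multiplicity `0` or `1`. -/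
def IsProjective {R : Type*} [Ring R] (K : Point R → ℕ) : Prop :=
  ∀ x, K x = 0 ∨ K x = 1

/-- A multiset of points is a `(k, n)`-arc if it has cardinality `k` and every line has
multiplicity at most `n`. The parameters are integers, so that they can be given by formulas with
subtractions. -/
def IsArc {R : Type*} [Ring R] (K : Point R → ℕ) (k n : ℤ) : Prop :=
  (multiplicity K Set.univ : ℤ) = k ∧ ∀ L : Line R, (multiplicity K L.points : ℤ) ≤ n

/-- `m_n(R)`: the largest size of a projective `(k, n)`-arc in the right projective Hjelmslev plane
over `R`. -/
noncomputable def maxArcSize (R : Type*) [Ring R] (n : ℕ) : ℕ :=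
  sSup {k : ℕ | ∃ K : Point R → ℕ, IsProjective K ∧ IsArc K k n}

end PHG

/-! The radical J is a one-dimensional left space over the residue field F, and J² = 0. So a point
is a neighbour class (a point of the projective plane over F) with two coordinates in F inside it,
and a line meets each affine neighbour class that it passes through in a line segment: those of
slope μ all in direction μ, vertical lines in vertical segments. Noncommutativity survives only as
an endomorphism of F (`twist`) in the equations of vertical lines and lines at infinity.

All arcs come from one family (`arcPoints`). Put |B| parallel segments of slope ξ in every class of
a column ξ ∈ W. A line of slope μ meets such a column in |B| points if ξ ≠ μ, and in at most one
whole segment, q points, if ξ = μ; a vertical line meets it in q|B| points. Every class of a column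
in Q receives one vertical segment. A sloped line takes one point from the column, and since the
positions of these segments form a conic, a vertical line takes at most 2q. Points at infinity then
fill the remaining slack: segments in the slope classes M disjoint from W, and a grid U in the
vertical class.

`exists_isArc` turns this into inequalities between cardinalities, and each arc is a choice of
sizes; in all but the smallest case |B| = 2. The bounds on m_n are the resulting sizes rewritten
with n = 2q + t. -/

/-- Coordinates on a ring `R` with residue field `F` and radical of square zero: the residue map,
an identification of `F` with the radical, and the endomorphism by which the right and the left
action of the residue field on the radical differ. -/
structure RadicalCoordinates (R F : Type*) [Ring R] [Field F] where
  residue : R →+* F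
  residue_surjective : Function.Surjective residue
  rad : F →+ R
  rad_injective : Function.Injective rad
  residue_rad : ∀ X, residue (rad X) = 0
  exists_rad : ∀ r, residue r = 0 → ∃ X, rad X = r
  mul_rad : ∀ r X, r * rad X = rad (residue r * X)
  twist : F →+* F
  rad_mul : ∀ X r, rad X * r = rad (X * twist (residue r))

/-! ### Structure of chain rings of length two. -/

namespace IsFiniteChainRingOfLengthTwo

variable {R : Type*} [Ring R]

/-- Since left ideals form a chain, J is the only maximal left ideal, so an element outside it has a
left inverse; finiteness makes this inverse two-sided. -/
theorem exists_mul_eq_one (hR : IsFiniteChainRingOfLengthTwo R) {r : R}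
    (hr : r ∉ Ring.jacobson R) : ∃ s, s * r = 1 ∧ r * s = 1 := by
  have := hR.finite
  have htop : Ideal.span {r} = (⊤ : Ideal R) := by
    by_contra hne
    obtain ⟨m, hm, hle⟩ := Ideal.exists_le_maximal _ hne
    apply hr
    rw [Ring.jacobson_eq_sInf_isMaximal, Submodule.mem_sInf]
    intro m' hm'
    have hm' : Ideal.IsMaximal m' := hm'
    have : m = m' := by
      rcases hR.left_chain m m' with h | h
      · exact hm.eq_of_le hm'.ne_top h
      · exact (hm'.eq_of_le hm.ne_top h).symm
    exact this ▸ hle (Ideal.subset_span rfl)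
  obtain ⟨s, hs⟩ := Ideal.mem_span_singleton'.1 ((Ideal.eq_top_iff_one _).1 htop)
  have hinj : Function.Injective fun x : R => r * x := by
    intro x y hxy
    have : s * (r * x) = s * (r * y) := congrArg (s * ·) hxy
    simpa [← mul_assoc, hs] using this
  obtain ⟨s', hs'⟩ := (Finite.injective_iff_surjective.1 hinj) 1
  have hs' : r * s' = 1 := hs'
  refine ⟨s, hs, ?_⟩
  have : s = s' := by
    calc s = s * (r * s') := by rw [hs', mul_one]
      _ = s' := by rw [← mul_assoc, hs, one_mul]
  rw [this, hs']

theorem isField_quotient (hR : IsFiniteChainRingOfLengthTwo R) :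
    IsField (R ⧸ Ring.jacobson R) := by
  have := hR.finite
  have hne : Ring.jacobson R ≠ ⊤ := by
    intro h
    have h1 : (1 : R) ∈ Ring.jacobson R := h ▸ Submodule.mem_top
    refine hR.radical_ne_bot ((Submodule.eq_bot_iff _).2 fun x hx => ?_)
    simpa using hR.radical_sq 1 h1 x hx
  have : Nontrivial (R ⧸ Ring.jacobson R) := Ideal.Quotient.nontrivial_iff.2 hne
  have hunit : ∀ a : R ⧸ Ring.jacobson R, a ≠ 0 → ∃ b, b * a = 1 ∧ a * b = 1 := by
    intro a ha
    obtain ⟨r, rfl⟩ := Ideal.Quotient.mk_surjective a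
    obtain ⟨s, hs, hs'⟩ := hR.exists_mul_eq_one fun h => ha (Ideal.Quotient.eq_zero_iff_mem.2 h)
    exact ⟨Ideal.Quotient.mk _ s, by rw [← map_mul, hs, map_one], by rw [← map_mul, hs', map_one]⟩
  have : NoZeroDivisors (R ⧸ Ring.jacobson R) := by
    refine ⟨fun {a b} hab => ?_⟩
    by_contra! h
    obtain ⟨c, hc, -⟩ := hunit a h.1
    apply h.2
    rw [← one_mul b, ← hc, mul_assoc, hab, mul_zero]
  have : Finite (R ⧸ Ring.jacobson R) := Finite.of_surjective _ Ideal.Quotient.mk_surjective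
  have : IsDomain (R ⧸ Ring.jacobson R) := NoZeroDivisors.to_isDomain _
  -- Wedderburn's little theorem supplies commutativity.
  exact Finite.isDomain_to_isField _

/-- Any θ ≠ 0 in J generates it as a left ideal, and rθ depends only on the residue of r because J²
= 0; this identifies F with J. The twist is read off from θr = g(r)θ. -/
theorem exists_radicalCoordinates {F : Type*} (hR : IsFiniteChainRingOfLengthTwo R)
    [Field F] (π : R →+* F) (hπ : Function.Surjective π)
    (hker : ∀ r, π r = 0 ↔ r ∈ Ring.jacobson R) : Nonempty (RadicalCoordinates R F) := by
  obtain ⟨θ, hθ, hθ0⟩ := (Submodule.ne_bot_iff _).1 hR.radical_ne_bot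
  have hzero : ∀ {r}, r * θ = 0 → π r = 0 := by
    intro r h
    rw [hker]
    by_contra hr
    obtain ⟨s, hs, -⟩ := hR.exists_mul_eq_one hr
    exact hθ0 (by rw [← one_mul θ, ← hs, mul_assoc, h, mul_zero])
  have hrep : ∀ {r r'}, π r = π r' → r * θ = r' * θ := by
    intro r r' h
    have : r - r' ∈ Ring.jacobson R := by rw [← hker, map_sub, h, sub_self]
    simpa [sub_mul, sub_eq_zero] using hR.radical_sq _ this _ hθ
  have hgen : ∀ j ∈ Ring.jacobson R, ∃ r, r * θ = j := by
    intro j hj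
    rcases hR.left_chain (Ideal.span {j}) (Ideal.span {θ}) with h | h
    · exact Ideal.mem_span_singleton'.1 (h (Ideal.subset_span rfl))
    · obtain ⟨r, hr⟩ := Ideal.mem_span_singleton'.1 (h (Ideal.subset_span rfl))
      have hrJ : r ∉ Ring.jacobson R := fun h' => hθ0 (by rw [← hr, hR.radical_sq r h' j hj])
      obtain ⟨s, hs, -⟩ := hR.exists_mul_eq_one hrJ
      exact ⟨s, by rw [← hr, ← mul_assoc, hs, one_mul]⟩
  let τ := Function.surjInv hπ
  have hτ : ∀ X, π (τ X) = X := Function.surjInv_eq hπ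
  have hmem : ∀ r, θ * r ∈ Ring.jacobson R := fun r => Ideal.mul_mem_right _ _ hθ
  choose g hg using fun r => hgen _ (hmem r)
  have hgu : ∀ {r s}, s * θ = θ * r → π (g r) = π s := by
    intro r s h
    have : (g r - s) * θ = 0 := by rw [sub_mul, hg, h, sub_self]
    simpa [sub_eq_zero] using hzero this
  have hgπ : ∀ {r r'}, π r = π r' → π (g r) = π (g r') := by
    intro r r' h
    apply hgu
    have : r - r' ∈ Ring.jacobson R := by rw [← hker, map_sub, h, sub_self]
    have := hR.radical_sq _ hθ _ this
    rw [mul_sub, sub_eq_zero] at this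
    rw [hg, this]
  refine ⟨{
    residue := π
    residue_surjective := hπ
    rad :=
      { toFun := fun X => τ X * θ
        map_zero' := by rw [hrep (r' := 0) (by rw [hτ, map_zero]), zero_mul]
        map_add' := fun X Y => by
          rw [← add_mul]
          exact hrep (by rw [hτ, map_add, hτ, hτ]) }
    rad_injective := ?_
    residue_rad := ?_
    exists_rad := ?_
    mul_rad := ?_
    twist :=
      { toFun := fun X => π (g (τ X))
        map_one' := by
          rw [hgπ (r' := 1) (by rw [hτ, map_one]), hgu (s := 1) (by rw [one_mul, mul_one]), map_one]
        map_mul' := fun X Y => by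
          rw [← map_mul, hgπ (r' := τ X * τ Y) (by rw [map_mul, hτ, hτ, hτ])]
          exact hgu (by rw [mul_assoc, hg, ← mul_assoc, hg, mul_assoc])
        map_zero' := by
          rw [hgπ (r' := 0) (by rw [hτ, map_zero]), hgu (s := 0) (by rw [zero_mul, mul_zero]),
            map_zero]
        map_add' := fun X Y => by
          rw [← map_add, hgπ (r' := τ X + τ Y) (by rw [map_add, hτ, hτ, hτ])]
          exact hgu (by rw [add_mul, hg, hg, mul_add]) }
    rad_mul := ?_ }⟩
  · intro X Y hXY
    have h : τ X * θ = τ Y * θ := hXY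
    have := hzero (r := τ X - τ Y) (by rw [sub_mul, h, sub_self])
    rwa [map_sub, hτ, hτ, sub_eq_zero] at this
  · intro X
    exact (hker _).2 (Ideal.mul_mem_left _ _ hθ)
  · intro r hr
    obtain ⟨s, rfl⟩ := hgen r ((hker r).1 hr)
    exact ⟨π s, hrep (hτ _)⟩
  · intro r X
    change r * (τ X * θ) = τ (π r * X) * θ
    rw [← mul_assoc]
    exact hrep (by rw [map_mul, hτ, hτ])
  · intro X r
    change τ X * θ * r = τ (X * π (g (τ (π r)))) * θ
    rw [mul_assoc, ← hg, ← mul_assoc]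
    exact hrep (by rw [map_mul, hτ, hτ, hgπ (hτ (π r))])

end IsFiniteChainRingOfLengthTwo

/-! ### Coordinates of points and incidence with lines. -/

/-- Coordinates of the points of a projective Hjelmslev plane: `affine ξ X η Y` lies in the
neighbour class `(ξ, η)` of the affine part, `slope s Z Y` in the neighbour class at infinity of
the lines of slope `s`, and `vertical Z Z'` in that of the vertical lines. -/
inductive ChartPoint (F : Type*) where
  | affine (ξ X η Y : F) : ChartPoint F
  | slope (s Z Y : F) : ChartPoint F
  | vertical (Z Z' : F) : ChartPoint F

namespace RadicalCoordinates

variable {R F : Type*} [Ring R] [Field F] (C : RadicalCoordinates R F)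

theorem exists_mul_eq_one {r : R} (hr : C.residue r ≠ 0) : ∃ s, s * r = 1 := by
  obtain ⟨s, hs⟩ := C.residue_surjective (C.residue r)⁻¹
  obtain ⟨X, hX⟩ := C.exists_rad (s * r - 1) (by simp [hs, hr])
  -- Here sr = 1 + j with j in the radical, and (1 - j)(1 + j) = 1.
  refine ⟨(1 - C.rad X) * s, ?_⟩
  rw [mul_assoc, eq_add_of_sub_eq hX.symm, sub_mul, one_mul, mul_add, C.mul_rad, C.residue_rad]
  simp

/-- A system of representatives of the residue classes. -/
noncomputable def lift : F → R := Function.surjInv C.residue_surjective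

@[simp] theorem residue_lift (X : F) : C.residue (C.lift X) = X :=
  Function.surjInv_eq C.residue_surjective X

/-- A basis of the line stays independent modulo J, so its 2 × 3 residue matrix has a nonzero kernel
vector α and full row rank. A lift of α annihilates the basis up to an error in J, which a
correction in J removes. -/
theorem exists_annihilator {L : Submodule Rᵐᵒᵖ (Fin 3 → R)} (hL : PHG.IsFreeOfRank 2 L) :
    ∃ a : Fin 3 → R, (∃ i, C.residue (a i) ≠ 0) ∧ ∀ x ∈ L, ∑ i, a i * x i = 0 := by
  obtain ⟨b⟩ := hL
  let u : Fin 2 → Fin 3 → R := fun k => b k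
  let M : Matrix (Fin 2) (Fin 3) F := Matrix.of fun k i => C.residue (u k i)
  have hli : LinearIndependent F M.row := by
    rw [Fintype.linearIndependent_iff]
    intro g hg
    have hb := Fintype.linearIndependent_iff.1 b.linearIndependent
      -- Multiplying a residue dependency into the radical gives a genuine dependency over `R`.
      (fun k => MulOpposite.op (C.rad (g k))) (by
        ext i
        have hi := congrFun hg i
        simp only [Finset.sum_apply, Pi.smul_apply, smul_eq_mul, Pi.zero_apply] at hi
        simp only [Submodule.coe_sum, Submodule.coe_smul, Finset.sum_apply, Pi.smul_apply,
          MulOpposite.smul_eq_mul_unop, MulOpposite.unop_op, C.mul_rad, ZeroMemClass.coe_zero,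
          Pi.zero_apply]
        rw [← map_sum, ← map_zero C.rad, ← hi]
        exact congrArg _ (Finset.sum_congr rfl fun k _ => mul_comm _ _))
    intro k
    have := hb k
    rw [MulOpposite.op_eq_zero_iff] at this
    exact C.rad_injective (by rw [this, map_zero])
  have hsurj : Function.Surjective M.mulVec := by
    have hrank := hli.rank_matrix
    have : LinearMap.range M.mulVecLin = ⊤ := by
      apply Submodule.eq_top_of_finrank_eq
      rw [← Matrix.rank, hrank]
      simp
    exact LinearMap.range_eq_top.1 this
  obtain ⟨N, hN⟩ := Matrix.mulVec_surjective_iff_exists_right_inverse.1 hsurj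
  have hN' : M.map C.twist * N.map C.twist = 1 := by
    rw [← Matrix.map_mul, hN, Matrix.map_one _ (map_zero _) (map_one _)]
  obtain ⟨α, hα, hα0⟩ := (Submodule.ne_bot_iff _).1
    (LinearMap.ker_ne_bot_of_finrank_lt (f := M.mulVecLin) (by simp))
  have hα : M.mulVec α = 0 := hα
  have hres : ∀ k, C.residue (∑ i, C.lift (α i) * u k i) = 0 := by
    intro k
    have := congrFun hα k
    simp only [Matrix.mulVec, dotProduct, Pi.zero_apply] at this
    rw [map_sum, ← this]
    exact Finset.sum_congr rfl fun i _ => by rw [map_mul, residue_lift, mul_comm]; rfl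
  choose e he using fun k => C.exists_rad _ (hres k)
  -- The correction stands to the left of the basis entries, so it sees their residues through the
  -- twist; the right inverse must be twisted too.
  let β := (N.map C.twist).mulVec (-e)
  have hβ : (M.map C.twist).mulVec β = -e := by
    simp only [β, Matrix.mulVec_mulVec, hN', Matrix.one_mulVec]
  refine ⟨fun i => C.lift (α i) + C.rad (β i), ?_, ?_⟩
  · by_contra! h
    apply hα0
    ext i
    simpa [C.residue_rad] using h i
  · let f : (Fin 3 → R) →ₗ[Rᵐᵒᵖ] R :=
      { toFun := fun x => ∑ i, (C.lift (α i) + C.rad (β i)) * x i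
        map_add' := fun x y => by simp [mul_add, Finset.sum_add_distrib]
        map_smul' := fun r x => by
          simp [MulOpposite.smul_eq_mul_unop, Finset.sum_mul, mul_assoc] }
    have hf : f.comp L.subtype = 0 := by
      refine b.ext fun k => ?_
      have hk := congrFun hβ k
      simp only [Matrix.mulVec, dotProduct, Pi.neg_apply] at hk
      change ∑ i, (C.lift (α i) + C.rad (β i)) * u k i = 0
      simp only [add_mul, Finset.sum_add_distrib, C.rad_mul]
      rw [← he, ← map_sum, ← map_add, ← map_zero C.rad]
      congr 1
      rw [← neg_eq_iff_add_eq_zero, ← hk]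
      exact Finset.sum_congr rfl fun i _ => mul_comm _ _
    intro x hx
    exact LinearMap.congr_fun hf ⟨x, hx⟩

/-- Every line satisfies an equation in which the coefficient of one coordinate is normalized. -/
theorem exists_equation (L : PHG.Line R) :
    (∃ m b : R, ∀ x ∈ L.1, x 2 = m * x 1 + b * x 0) ∨
    (∃ (c : R) (D : F), ∀ x ∈ L.1, x 1 = c * x 0 + C.rad D * x 2) ∨
    (∃ D E : F, ∀ x ∈ L.1, x 0 = C.rad D * x 1 + C.rad E * x 2) := by
  obtain ⟨a, ha, h⟩ := C.exists_annihilator L.2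
  simp only [Fin.sum_univ_three] at h
  have key : ∀ {i}, C.residue (a i) ≠ 0 → ∃ s, s * a i = 1 := fun hi => C.exists_mul_eq_one hi
  -- Normalize the last coefficient that is a unit; the coefficients after it lie in the radical.
  by_cases h2 : C.residue (a 2) = 0
  · by_cases h1 : C.residue (a 1) = 0
    · have h0 : C.residue (a 0) ≠ 0 := by
        obtain ⟨i, hi⟩ := ha
        fin_cases i
        · exact hi
        · exact absurd h1 hi
        · exact absurd h2 hi
      obtain ⟨s, hs⟩ := key h0
      obtain ⟨D, hD⟩ := C.exists_rad (-(s * a 1)) (by simp [h1])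
      obtain ⟨E, hE⟩ := C.exists_rad (-(s * a 2)) (by simp [h2])
      refine Or.inr (Or.inr ⟨D, E, fun x hx => ?_⟩)
      have := congrArg (s * ·) (h x hx)
      simp only [mul_add, ← mul_assoc, hs, one_mul, mul_zero] at this
      rw [hD, hE, ← sub_eq_zero, ← this]
      noncomm_ring
    · obtain ⟨s, hs⟩ := key h1
      obtain ⟨D, hD⟩ := C.exists_rad (-(s * a 2)) (by simp [h2])
      refine Or.inr (Or.inl ⟨-(s * a 0), D, fun x hx => ?_⟩)
      have := congrArg (s * ·) (h x hx)
      simp only [mul_add, ← mul_assoc, hs, one_mul, mul_zero] at this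
      rw [hD, ← sub_eq_zero, ← this]
      noncomm_ring
  · obtain ⟨s, hs⟩ := key h2
    refine Or.inl ⟨-(s * a 1), -(s * a 0), fun x hx => ?_⟩
    have := congrArg (s * ·) (h x hx)
    simp only [mul_add, ← mul_assoc, hs, one_mul, mul_zero] at this
    rw [← sub_eq_zero, ← this]
    noncomm_ring

/-- A generator of the point with the given coordinates. -/
noncomputable def vec : ChartPoint F → Fin 3 → R
  | .affine ξ X η Y => ![1, C.lift ξ + C.rad X, C.lift η + C.rad Y]
  | .slope s Z Y => ![C.rad Z, 1, C.lift s + C.rad Y]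
  | .vertical Z Z' => ![C.rad Z, C.rad Z', 1]

theorem linearIndependent_vec (p : ChartPoint F) :
    LinearIndependent Rᵐᵒᵖ fun _ : Fin 1 => C.vec p := by
  rw [Fintype.linearIndependent_iff]
  intro g hg k
  simp only [Finset.univ_unique, Finset.sum_singleton] at hg
  rw [Subsingleton.elim k default, ← MulOpposite.unop_eq_zero_iff]
  cases p
  · simpa [vec] using congrFun hg 0
  · simpa [vec] using congrFun hg 1
  · simpa [vec] using congrFun hg 2

/-- The point with the given coordinates. -/
noncomputable def point (p : ChartPoint F) : PHG.Point R :=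
  ⟨Submodule.span Rᵐᵒᵖ (Set.range fun _ : Fin 1 => C.vec p),
    ⟨Module.Basis.span (C.linearIndependent_vec p)⟩⟩

theorem vec_mem_point (p : ChartPoint F) : C.vec p ∈ (C.point p).1 :=
  Submodule.subset_span ⟨0, rfl⟩

theorem exists_mul_of_point_eq {p p' : ChartPoint F} (h : C.point p = C.point p') :
    ∃ r, ∀ i, C.vec p' i = C.vec p i * r := by
  have := C.vec_mem_point p'
  rw [← h] at this
  simp only [point, Set.range_const, Submodule.mem_span_singleton] at this
  obtain ⟨r, hr⟩ := this
  exact ⟨r.unop, fun i => by rw [← hr]; rfl⟩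

theorem lift_add_rad_inj {X Y X' Y' : F} (h : C.lift X + C.rad Y = C.lift X' + C.rad Y') :
    X = X' ∧ Y = Y' := by
  have hX : X = X' := by simpa [C.residue_rad] using congrArg C.residue h
  subst hX
  exact ⟨rfl, C.rad_injective (add_left_cancel h)⟩

/-- Generators of equal points differ by a right factor. For points of the same kind the normalized
coordinate forces this factor to be 1; different kinds already disagree modulo J. -/
theorem point_injective : Function.Injective C.point := by
  intro p p' h
  obtain ⟨r, hr⟩ := C.exists_mul_of_point_eq h
  have h0 := hr 0
  have h1 := hr 1
  have h2 := hr 2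
  have e0 := congrArg C.residue h0
  have e1 := congrArg C.residue h1
  have e2 := congrArg C.residue h2
  rcases p with ⟨ξ, X, η, Y⟩ | ⟨s, Z, Y⟩ | ⟨Z, Z'⟩ <;>
  rcases p' with ⟨ξ', X', η', Y'⟩ | ⟨s', Z₁, Y'⟩ | ⟨Z₁, Z₁'⟩ <;>
  simp [vec, C.residue_rad] at h0 h1 h2 e0 e1 e2
  · subst h0
    rw [mul_one] at h1 h2
    obtain ⟨rfl, rfl⟩ := C.lift_add_rad_inj h1
    obtain ⟨rfl, rfl⟩ := C.lift_add_rad_inj h2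
    rfl
  · subst h0
    simp [C.residue_rad] at e1
  · subst h0
    simp [C.residue_rad] at e2
  · subst h1
    rw [mul_one] at h0 h2
    obtain rfl := C.rad_injective h0
    obtain ⟨rfl, rfl⟩ := C.lift_add_rad_inj h2
    rfl
  · rw [← e1, mul_zero] at e2
    exact absurd e2 one_ne_zero
  · subst h2
    rw [mul_one] at h0 h1
    obtain rfl := C.rad_injective h0
    obtain rfl := C.rad_injective h1
    rfl

/-- Incidence in coordinates with a line of slope `μ`. -/
def OnSloped (μ β : F) (c : F → F) (c' : F) : ChartPoint F → Prop
  | .affine ξ X η Y => η = μ * ξ + β ∧ Y = μ * X + c ξ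
  | .slope s Z Y => s = μ ∧ Y = β * Z + c'
  | .vertical _ _ => False

/-- Incidence in coordinates with a vertical line. -/
def OnVertical (γ c D : F) : ChartPoint F → Prop
  | .affine ξ X η _ => ξ = γ ∧ X = c + D * C.twist η
  | .slope _ _ _ => False
  | .vertical Z Z' => Z' = γ * Z + D

/-- Incidence in coordinates with a line at infinity. -/
def AtInfinity (D E : F) : ChartPoint F → Prop
  | .affine _ _ _ _ => False
  | .slope s Z _ => Z = D + E * C.twist s
  | .vertical Z _ => Z = E

theorem exists_incidence (L : PHG.Line R) :
    (∃ μ β c c', ∀ p, C.point p ∈ L.points → OnSloped μ β c c' p) ∨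
    (∃ γ c D, ∀ p, C.point p ∈ L.points → C.OnVertical γ c D p) ∨
    (∃ D E, ∀ p, C.point p ∈ L.points → C.AtInfinity D E p) := by
  have hmem : ∀ p, C.point p ∈ L.points → C.vec p ∈ L.1 := fun p hp => hp (C.vec_mem_point p)
  rcases C.exists_equation L with ⟨m, b, h⟩ | ⟨c, D, h⟩ | ⟨D, E, h⟩
  -- The lift need not be additive or multiplicative, so the constant term is an arbitrary function
  -- of the column ξ.
  · choose c hc using fun ξ => C.exists_rad
      (m * C.lift ξ + b - C.lift (C.residue m * ξ + C.residue b)) (by simp)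
    obtain ⟨c', hc'⟩ := C.exists_rad (m - C.lift (C.residue m)) (by simp)
    refine Or.inl ⟨C.residue m, C.residue b, c, c', fun p hp => ?_⟩
    have hp := h _ (hmem p hp)
    have hp' := congrArg C.residue hp
    rcases p with ⟨ξ, X, η, Y⟩ | ⟨s, Z, Y⟩ | ⟨Z, Z'⟩
    · simp [vec, C.residue_rad] at hp hp'
      refine ⟨hp', C.rad_injective ?_⟩
      rw [map_add, hc, ← C.mul_rad, ← hp', ← sub_eq_zero, ← sub_eq_zero.2 hp]
      noncomm_ring
    · simp [vec, C.residue_rad] at hp hp'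
      refine ⟨hp', C.rad_injective ?_⟩
      rw [map_add, hc', ← C.mul_rad, ← hp', ← sub_eq_zero, ← sub_eq_zero.2 hp]
      noncomm_ring
    · simp [vec, C.residue_rad] at hp'
  · obtain ⟨e, he⟩ := C.exists_rad (c - C.lift (C.residue c)) (by simp)
    refine Or.inr (Or.inl ⟨C.residue c, e, D, fun p hp => ?_⟩)
    have hp := h _ (hmem p hp)
    have hp' := congrArg C.residue hp
    rcases p with ⟨ξ, X, η, Y⟩ | ⟨s, Z, Y⟩ | ⟨Z, Z'⟩
    · simp [vec, C.residue_rad] at hp hp'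
      refine ⟨hp', C.rad_injective ?_⟩
      have := C.rad_mul D (C.lift η + C.rad Y)
      simp [C.residue_rad] at this
      rw [map_add, he, ← this, ← hp', ← sub_eq_zero, ← sub_eq_zero.2 hp]
      noncomm_ring
    · simp [vec, C.residue_rad] at hp'
    · simp [vec, C.residue_rad] at hp hp'
      exact C.rad_injective (by rw [hp, map_add, C.mul_rad])
  · refine Or.inr (Or.inr ⟨D, E, fun p hp => ?_⟩)
    have hp := h _ (hmem p hp)
    have hp' := congrArg C.residue hp
    rcases p with ⟨ξ, X, η, Y⟩ | ⟨s, Z, Y⟩ | ⟨Z, Z'⟩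
    · simp [vec, C.residue_rad] at hp'
    · simp [vec, C.residue_rad] at hp hp'
      exact C.rad_injective (by rw [hp, C.rad_mul]; simp [C.residue_rad])
    · simp [vec, C.residue_rad] at hp hp'
      exact C.rad_injective (by rw [hp, C.mul_rad]; simp [C.residue_rad])

end RadicalCoordinates

/-- This is the conic property: a vertical line has the equation X = c + D · `twist` η, so it meets
at most two of the segments X = (`twist` η)². -/
theorem card_quadratic_roots_le_two {F G : Type*} [Field F] [Fintype G] {f : G → F}
    (hf : Function.Injective f) (c D : F) [DecidablePred fun η => f η ^ 2 = c + D * f η] :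
    (Finset.univ.filter fun η => f η ^ 2 = c + D * f η).card ≤ 2 := by
  by_contra! h
  obtain ⟨x, hx, y, hy, z, hz, hxy, hxz, hyz⟩ := Finset.two_lt_card.1 h
  simp only [Finset.mem_filter, Finset.mem_univ, true_and] at hx hy hz
  have hne : ∀ {u v}, u ≠ v → f u ^ 2 = c + D * f u → f v ^ 2 = c + D * f v → f u + f v = D := by
    intro u v huv hu hv
    have : (f u - f v) * (f u + f v - D) = 0 := by linear_combination hu - hv
    rcases mul_eq_zero.1 this with h | h
    · exact absurd (hf (sub_eq_zero.1 h)) huv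
    · exact sub_eq_zero.1 h
  exact hyz (hf (add_left_cancel ((hne hxy hx hy).trans (hne hxz hx hz).symm)))

/-! ### Arcs from finite point sets. -/

namespace PHG

variable {R : Type*} [Ring R]

open Classical in
theorem multiplicity_indicator (S : Finset (Point R)) (T : Set (Point R)) :
    multiplicity (fun x => if x ∈ S then 1 else 0) T = (S.filter (· ∈ T)).card := by
  rw [multiplicity, finsum_mem_eq_sum_of_inter_support_eq (t := S.filter (· ∈ T)),
    Finset.card_eq_sum_ones]
  · refine Finset.sum_congr rfl fun x hx => if_pos (Finset.mem_filter.1 hx).1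
  · ext x
    simp
    tauto

open Classical in
theorem exists_isArc_of_card_le (S : Finset (Point R)) {k n : ℤ} (hk : 0 ≤ k)
    (hkS : k ≤ S.card) (hn : ∀ L : Line R, ((S.filter (· ∈ L.points)).card : ℤ) ≤ n) :
    ∃ K : Point R → ℕ, IsProjective K ∧ IsArc K k n := by
  lift k to ℕ using hk
  obtain ⟨S', hS', rfl⟩ := Finset.exists_subset_card_eq (Nat.cast_le.1 hkS)
  refine ⟨fun x => if x ∈ S' then 1 else 0, fun x => ?_, ?_, fun L => ?_⟩
  · by_cases h : x ∈ S' <;> simp [h]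
  · rw [multiplicity_indicator]
    simp
  · rw [multiplicity_indicator]
    exact le_trans (Nat.cast_le.2 (Finset.card_le_card (Finset.filter_subset_filter _ hS'))) (hn L)

theorem le_maxArcSize [Finite R] {n : ℕ} {k : ℤ} (hk : 0 ≤ k)
    (h : ∃ K : Point R → ℕ, IsProjective K ∧ IsArc K k n) : k ≤ maxArcSize R n := by
  classical
  lift k to ℕ using hk
  have : Finite (Submodule Rᵐᵒᵖ (Fin 3 → R)) :=
    Finite.of_injective (fun U => (U : Set (Fin 3 → R))) SetLike.coe_injective
  have : Finite (Point R) := Subtype.finite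
  -- The supremum is meaningful only for a bounded set; a projective multiset has at most as many
  -- points as the plane.
  refine Nat.cast_le.2 (le_csSup ⟨Nat.card (Point R), ?_⟩ h)
  rintro m ⟨K, hK, hm, -⟩
  have := Fintype.ofFinite (Point R)
  rw [Nat.cast_inj] at hm
  rw [← hm, multiplicity, finsum_mem_univ, finsum_eq_sum_of_fintype, Nat.card_eq_fintype_card,
    ← Finset.card_univ, Finset.card_eq_sum_ones]
  exact Finset.sum_le_sum fun x _ => by rcases hK x with h | h <;> simp [h]

end PHG

/-! ### The family of arcs and its line multiplicities. -/

namespace RadicalCoordinates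

variable {R F : Type*} [Ring R] [Field F] [Fintype F] (C : RadicalCoordinates R F)
  (W Q M B A : Finset F) (U : Finset (F × F))

open Classical in
/-- The points of the arcs: in the neighbour classes of a column of `W` the segments of a slope
depending on the column whose intercept lies in `B`, in those of a column of `Q` one vertical
segment, these being in conic position, in the classes at infinity with slope in `M` the segments
in the direction of the line at infinity with position in `A`, and in the vertical class the
set `U`. -/
noncomputable def arcPoints : Finset (ChartPoint F) :=
  (((W ×ˢ Finset.univ ×ˢ Finset.univ ×ˢ B).image fun x : F × F × F × F =>
      .affine x.1 x.2.1 x.2.2.1 (x.1 * x.2.1 + x.2.2.2)) ∪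
    (Q ×ˢ Finset.univ ×ˢ Finset.univ).image fun x : F × F × F =>
      .affine x.1 (C.twist x.2.1 ^ 2) x.2.1 x.2.2) ∪
  (((M ×ˢ A ×ˢ Finset.univ).image fun x : F × F × F => .slope x.1 x.2.1 x.2.2) ∪
    U.image fun x => .vertical x.1 x.2)

theorem card_arcPoints (hWQ : Disjoint W Q) :
    (C.arcPoints W Q M B A U).card =
      Fintype.card F ^ 2 * (W.card * B.card) + Fintype.card F ^ 2 * Q.card +
        (Fintype.card F * (M.card * A.card) + U.card) := by
  classical
  rw [arcPoints, Finset.card_union_of_disjoint, Finset.card_union_of_disjoint,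
    Finset.card_union_of_disjoint, Finset.card_image_of_injOn, Finset.card_image_of_injOn,
    Finset.card_image_of_injOn, Finset.card_image_of_injOn]
  · simp only [Finset.card_product, Finset.card_univ]
    ring
  · rintro ⟨a, b⟩ - ⟨a', b'⟩ - h
    simpa using h
  · rintro ⟨a, b, c⟩ - ⟨a', b', c'⟩ - h
    simpa using h
  · rintro ⟨a, b, c⟩ - ⟨a', b', c'⟩ - h
    simp at h ⊢
    tauto
  · rintro ⟨a, b, c, d⟩ - ⟨a', b', c', d'⟩ - h
    simp at h ⊢
    obtain ⟨rfl, rfl, rfl, h⟩ := h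
    simpa using h
  · rw [Finset.disjoint_left]
    intro p hp hp'
    obtain ⟨x, -, rfl⟩ := Finset.mem_image.1 hp
    simp at hp'
  · rw [Finset.disjoint_left]
    simp only [Finset.mem_image, Finset.mem_product, Finset.mem_univ, true_and, not_exists, not_and]
    rintro _ ⟨⟨a, b, c, d⟩, ⟨ha, -⟩, rfl⟩ ⟨a', b', c'⟩ ⟨ha', -⟩ h
    simp at h ha ha'
    exact Finset.disjoint_left.1 hWQ ha (h.1 ▸ ha')
  · rw [Finset.disjoint_left]
    intro p hp hp'
    simp only [Finset.mem_union, Finset.mem_image] at hp hp'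
    rcases hp with ⟨x, -, rfl⟩ | ⟨x, -, rfl⟩ <;> simp at hp'

open Classical in
-- A union bound over the four kinds of points, stated for sets of parameters so that each kind can
-- be counted by an injection.
theorem card_filter_arcPoints_le {P : ChartPoint F → Prop} {a b c d : ℕ}
    (ha : ∀ s : Finset (F × F × F × F), (∀ ξ X η b, (ξ, X, η, b) ∈ s → ξ ∈ W ∧ b ∈ B ∧
      P (.affine ξ X η (ξ * X + b))) → s.card ≤ a)
    (hb : ∀ s : Finset (F × F × F), (∀ ξ η Y, (ξ, η, Y) ∈ s → ξ ∈ Q ∧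
      P (.affine ξ (C.twist η ^ 2) η Y)) → s.card ≤ b)
    (hc : ∀ s : Finset (F × F × F), (∀ m Z Y, (m, Z, Y) ∈ s → m ∈ M ∧ Z ∈ A ∧
      P (.slope m Z Y)) → s.card ≤ c)
    (hd : ∀ s : Finset (F × F), (∀ Z Z', (Z, Z') ∈ s → (Z, Z') ∈ U ∧ P (.vertical Z Z')) → s.card ≤ d) :
    ((C.arcPoints W Q M B A U).filter P).card ≤ a + b + (c + d) := by
  simp only [arcPoints, Finset.filter_union, Finset.filter_image]
  refine (Finset.card_union_le _ _).trans (Nat.add_le_add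
    ((Finset.card_union_le _ _).trans (Nat.add_le_add
      (Finset.card_image_le.trans (ha _ ?_)) (Finset.card_image_le.trans (hb _ ?_))))
    ((Finset.card_union_le _ _).trans (Nat.add_le_add
      (Finset.card_image_le.trans (hc _ ?_)) (Finset.card_image_le.trans (hd _ ?_)))))
  · intro _ _ _ _ hx
    simp only [Finset.mem_filter, Finset.mem_product, Finset.mem_univ, true_and] at hx
    tauto
  · intro _ _ _ hx
    simp only [Finset.mem_filter, Finset.mem_product, Finset.mem_univ, and_true] at hx
    tauto
  · intro _ _ _ hx
    simp only [Finset.mem_filter, Finset.mem_product, Finset.mem_univ, and_true] at hx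
    tauto
  · intro _ _ hx
    exact Finset.mem_filter.1 hx

open Classical in
theorem card_filter_onSloped_le (μ β : F) (c : F → F) (c' : F) :
    ((C.arcPoints W Q M B A U).filter (OnSloped μ β c c')).card ≤
      (if μ ∈ W then Fintype.card F else 0) + (W.erase μ).card * B.card + Q.card +
        ((if μ ∈ M then A.card else 0) + 0) := by
  refine C.card_filter_arcPoints_le W Q M B A U (fun s hs => ?_) (fun s hs => ?_)
    (fun s hs => ?_) (fun s hs => ?_)
  · rw [← Finset.card_filter_add_card_filter_not (fun x : F × F × F × F => x.1 = μ)]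
    refine Nat.add_le_add ?_ ?_
    -- In column μ the segments are parallel to the line, so only one intercept can occur and X
    -- determines the point.
    · split_ifs with hμ
      · rw [← Finset.card_univ]
        refine Finset.card_le_card_of_injOn (fun x => x.2.1) (fun _ _ => Finset.mem_univ _) ?_
        rintro ⟨ξ, X, η, b⟩ h ⟨ξ', X', η', b'⟩ h' e
        obtain ⟨g, e₁ : ξ = μ⟩ := Finset.mem_filter.1 h
        obtain ⟨g', e₂ : ξ' = μ⟩ := Finset.mem_filter.1 h'
        subst e₁
        subst e₂
        obtain ⟨-, -, rfl, k⟩ := hs _ _ _ _ g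
        obtain ⟨-, -, rfl, k'⟩ := hs _ _ _ _ g'
        obtain rfl : X = X' := e
        obtain rfl : b = b' := add_left_cancel (k.trans k'.symm)
        rfl
      · rw [Nat.le_zero, Finset.card_eq_zero, Finset.filter_eq_empty_iff]
        rintro ⟨ξ, X, η, b⟩ h rfl
        exact hμ (hs _ _ _ _ h).1
    · rw [← Finset.card_product]
      refine Finset.card_le_card_of_injOn (fun x => (x.1, x.2.2.2)) ?_ ?_
      · rintro ⟨ξ, X, η, b⟩ h
        obtain ⟨h, hne⟩ := Finset.mem_filter.1 h
        exact Finset.mem_product.2 ⟨Finset.mem_erase.2 ⟨hne, (hs _ _ _ _ h).1⟩, (hs _ _ _ _ h).2.1⟩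
      · rintro ⟨ξ, X, η, b⟩ h ⟨ξ', X', η', b'⟩ h' e
        simp only [Prod.mk.injEq] at e
        obtain ⟨rfl, rfl⟩ := e
        obtain ⟨g, hne⟩ := Finset.mem_filter.1 h
        obtain ⟨-, -, rfl, k⟩ := hs _ _ _ _ g
        obtain ⟨-, -, rfl, k'⟩ := hs _ _ _ _ (Finset.mem_filter.1 h').1
        -- Off column μ the two directions differ: (ξ - μ)X is determined by the column and the
        -- intercept.
        obtain rfl : X = X' :=
          mul_left_cancel₀ (sub_ne_zero.2 hne) (by linear_combination k - k')
        rfl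
  · refine Finset.card_le_card_of_injOn (fun x => x.1) (fun x hx => (hs _ _ _ hx).1) ?_
    rintro ⟨ξ, η, Y⟩ h ⟨ξ', η', Y'⟩ h' e
    obtain rfl : ξ = ξ' := e
    obtain ⟨-, rfl, rfl⟩ := hs _ _ _ h
    obtain ⟨-, rfl, rfl⟩ := hs _ _ _ h'
    rfl
  · split_ifs with hμ
    · refine Finset.card_le_card_of_injOn (fun x => x.2.1) (fun x hx => (hs _ _ _ hx).2.1) ?_
      rintro ⟨s, Z, Y⟩ h ⟨s', Z', Y'⟩ h' e
      obtain rfl : Z = Z' := e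
      obtain ⟨-, -, rfl, rfl⟩ := hs _ _ _ h
      obtain ⟨-, -, rfl, rfl⟩ := hs _ _ _ h'
      rfl
    · rw [Nat.le_zero, Finset.card_eq_zero, Finset.eq_empty_iff_forall_notMem]
      intro x hx
      obtain ⟨h, -, rfl, -⟩ := hs _ _ _ hx
      exact hμ h
  · rw [Nat.le_zero, Finset.card_eq_zero, Finset.eq_empty_iff_forall_notMem]
    exact fun x hx => (hs _ _ hx).2

open Classical in
theorem card_filter_onVertical_le (γ c D : F) :
    ((C.arcPoints W Q M B A U).filter (C.OnVertical γ c D)).card ≤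
      (if γ ∈ W then Fintype.card F * B.card else 0) +
        (if γ ∈ Q then 2 * Fintype.card F else 0) +
        (0 + (U.filter fun x => x.2 = γ * x.1 + D).card) := by
  refine C.card_filter_arcPoints_le W Q M B A U (fun s hs => ?_) (fun s hs => ?_)
    (fun s hs => ?_) (fun s hs => ?_)
  · split_ifs with hγ
    · rw [← Finset.card_univ, ← Finset.card_product]
      refine Finset.card_le_card_of_injOn (fun x => (x.2.2.1, x.2.2.2))
        (fun x hx => Finset.mem_product.2 ⟨Finset.mem_univ _, (hs _ _ _ _ hx).2.1⟩) ?_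
      rintro ⟨ξ, X, η, b⟩ h ⟨ξ', X', η', b'⟩ h' e
      simp only [Prod.mk.injEq] at e
      obtain ⟨rfl, rfl⟩ := e
      obtain ⟨-, -, rfl, rfl⟩ := hs _ _ _ _ h
      obtain ⟨-, -, rfl, rfl⟩ := hs _ _ _ _ h'
      rfl
    · rw [Nat.le_zero, Finset.card_eq_zero, Finset.eq_empty_iff_forall_notMem]
      intro x hx
      obtain ⟨h, -, rfl, -⟩ := hs _ _ _ _ hx
      exact hγ h
  · split_ifs with hγ
    · refine le_trans ?_ (Nat.mul_le_mul_right _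
        (card_quadratic_roots_le_two C.twist.injective c D))
      rw [← Finset.card_univ, ← Finset.card_product]
      refine Finset.card_le_card_of_injOn (fun x => (x.2.1, x.2.2)) (fun x hx => ?_) ?_
      · exact Finset.mem_product.2
          ⟨Finset.mem_filter.2 ⟨Finset.mem_univ _, (hs _ _ _ hx).2.2⟩, Finset.mem_univ _⟩
      · rintro ⟨ξ, η, Y⟩ h ⟨ξ', η', Y'⟩ h' e
        simp only [Prod.mk.injEq] at e
        obtain ⟨rfl, rfl⟩ := e
        obtain ⟨-, rfl, -⟩ := hs _ _ _ h
        obtain ⟨-, rfl, -⟩ := hs _ _ _ h'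
        rfl
    · rw [Nat.le_zero, Finset.card_eq_zero, Finset.eq_empty_iff_forall_notMem]
      intro x hx
      obtain ⟨h, rfl, -⟩ := hs _ _ _ hx
      exact hγ h
  · rw [Nat.le_zero, Finset.card_eq_zero, Finset.eq_empty_iff_forall_notMem]
    exact fun x hx => (hs _ _ _ hx).2.2
  · exact Finset.card_le_card fun x hx => Finset.mem_filter.2 (hs _ _ hx)

open Classical in
theorem card_filter_atInfinity_le (D E : F) :
    ((C.arcPoints W Q M B A U).filter (C.AtInfinity D E)).card ≤
      0 + 0 + (M.card * Fintype.card F + (U.filter fun x => x.1 = E).card) := by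
  refine C.card_filter_arcPoints_le W Q M B A U (fun s hs => ?_) (fun s hs => ?_)
    (fun s hs => ?_) (fun s hs => ?_)
  · rw [Nat.le_zero, Finset.card_eq_zero, Finset.eq_empty_iff_forall_notMem]
    exact fun x hx => (hs _ _ _ _ hx).2.2
  · rw [Nat.le_zero, Finset.card_eq_zero, Finset.eq_empty_iff_forall_notMem]
    exact fun x hx => (hs _ _ _ hx).2
  · rw [← Finset.card_univ, ← Finset.card_product]
    refine Finset.card_le_card_of_injOn (fun x => (x.1, x.2.2))
      (fun x hx => Finset.mem_product.2 ⟨(hs _ _ _ hx).1, Finset.mem_univ _⟩) ?_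
    rintro ⟨s, Z, Y⟩ h ⟨s', Z', Y'⟩ h' e
    simp only [Prod.mk.injEq] at e
    obtain ⟨rfl, rfl⟩ := e
    obtain ⟨-, -, rfl⟩ := hs _ _ _ h
    obtain ⟨-, -, rfl⟩ := hs _ _ _ h'
    rfl
  · exact Finset.card_le_card fun x hx => Finset.mem_filter.2 (hs _ _ hx)

open Classical in
-- The hypotheses after the size bound treat slopes in W, slopes outside W, vertical lines and lines
-- at infinity. The size is only bounded, since surplus points can be dropped.
theorem exists_isArc (C : RadicalCoordinates R F) {k n : ℤ} (hWQ : Disjoint W Q) (hWM : Disjoint W M) (hk : 0 ≤ k)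
    (hsize : k ≤ (Fintype.card F : ℤ) ^ 2 * (W.card * B.card) + (Fintype.card F : ℤ) ^ 2 * Q.card +
      (Fintype.card F * (M.card * A.card) + U.card))
    (hW : ∀ μ ∈ W, (Fintype.card F : ℤ) + (W.card - 1) * B.card + Q.card ≤ n)
    (hM : ∀ μ ∉ W, (W.card * B.card + Q.card : ℤ) + (if μ ∈ M then A.card else 0 : ℕ) ≤ n)
    (hvert : ∀ γ D, (if γ ∈ W then Fintype.card F * B.card else 0 : ℕ) +
      (if γ ∈ Q then 2 * Fintype.card F else 0 : ℕ) +
      ((U.filter fun x => x.2 = γ * x.1 + D).card : ℤ) ≤ n)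
    (hinf : ∀ E, (M.card * Fintype.card F : ℤ) + (U.filter fun x => x.1 = E).card ≤ n) :
    ∃ K : PHG.Point R → ℕ, PHG.IsProjective K ∧ PHG.IsArc K k n := by
  refine PHG.exists_isArc_of_card_le ((C.arcPoints W Q M B A U).image C.point) hk ?_ fun L => ?_
  · rw [Finset.card_image_of_injective _ C.point_injective, C.card_arcPoints W Q M B A U hWQ]
    push_cast
    exact hsize
  rw [Finset.filter_image, Finset.card_image_of_injective _ C.point_injective]
  have hsub : ∀ {P : ChartPoint F → Prop}, (∀ p, C.point p ∈ L.points → P p) →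
      ((C.arcPoints W Q M B A U).filter fun p => C.point p ∈ L.points).card ≤
        ((C.arcPoints W Q M B A U).filter P).card := fun h =>
    Finset.card_le_card (Finset.monotone_filter_right _ fun p _ hp => h p hp)
  rcases C.exists_incidence L with ⟨μ, β, c, c', h⟩ | ⟨γ, c, D, h⟩ | ⟨D, E, h⟩
  · have hle := (hsub h).trans (C.card_filter_onSloped_le W Q M B A U μ β c c')
    refine (Nat.cast_le.2 hle).trans ?_
    by_cases hμ : μ ∈ W
    · have hpos := Finset.card_pos.2 ⟨μ, hμ⟩
      have := hW μ hμ
      rw [if_pos hμ, if_neg (Finset.disjoint_left.1 hWM hμ), Finset.card_erase_of_mem hμ]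
      push_cast [Nat.cast_sub hpos]
      simpa using this
    · have := hM μ hμ
      rw [if_neg hμ, Finset.erase_eq_of_notMem hμ]
      push_cast at this ⊢
      simpa using this
  · have hle := (hsub h).trans (C.card_filter_onVertical_le W Q M B A U γ c D)
    refine (Nat.cast_le.2 hle).trans ?_
    have := hvert γ D
    push_cast at this ⊢
    simpa using this
  · have hle := (hsub h).trans (C.card_filter_atInfinity_le W Q M B A U D E)
    refine (Nat.cast_le.2 hle).trans ?_
    have := hinf E
    push_cast at this ⊢
    simpa using this

end RadicalCoordinates

/-! ### Lines meeting a grid in the vertical class. -/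

theorem card_filter_product_line_le {F : Type*} [Field F] (S T : Finset F) (γ D : F)
    [DecidablePred fun x : F × F => x.2 = γ * x.1 + D] :
    ((S ×ˢ T).filter fun x => x.2 = γ * x.1 + D).card ≤ S.card ∧
      (γ ≠ 0 → ((S ×ˢ T).filter fun x => x.2 = γ * x.1 + D).card ≤ T.card) := by
  refine ⟨Finset.card_le_card_of_injOn (fun x => x.1) ?_ ?_,
    fun hγ => Finset.card_le_card_of_injOn (fun x => x.2) ?_ ?_⟩
  · exact fun x hx => (Finset.mem_product.1 (Finset.mem_filter.1 hx).1).1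
  · rintro ⟨a, b⟩ h ⟨a', b'⟩ h' e
    obtain rfl : a = a' := e
    have h : b = γ * a + D := (Finset.mem_filter.1 h).2
    have h' : b' = γ * a + D := (Finset.mem_filter.1 h').2
    rw [h, h']
  · exact fun x hx => (Finset.mem_product.1 (Finset.mem_filter.1 hx).1).2
  · rintro ⟨a, b⟩ h ⟨a', b'⟩ h' e
    obtain rfl : b = b' := e
    have h : b = γ * a + D := (Finset.mem_filter.1 h).2
    have h' : b = γ * a' + D := (Finset.mem_filter.1 h').2
    obtain rfl : a = a' := mul_left_cancel₀ hγ (add_right_cancel (h.symm.trans h'))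
    rfl

theorem card_filter_product_fst_le {F : Type*} (S T : Finset F) (E : F)
    [DecidablePred fun x : F × F => x.1 = E] :
    ((S ×ˢ T).filter fun x => x.1 = E).card ≤ T.card := by
  refine Finset.card_le_card_of_injOn (fun x => x.2) ?_ ?_
  · exact fun x hx => (Finset.mem_product.1 (Finset.mem_filter.1 hx).1).2
  · rintro ⟨a, b⟩ h ⟨a', b'⟩ h' e
    obtain rfl : a = _ := (Finset.mem_filter.1 h).2
    obtain rfl : a' = _ := (Finset.mem_filter.1 h').2
    exact Prod.ext rfl e

theorem exists_finset_card_eq {F : Type*} [Fintype F] {n : ℕ} (h : n ≤ Fintype.card F) :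
    ∃ S : Finset F, S.card = n := by
  obtain ⟨S, -, hS⟩ := Finset.exists_subset_card_eq (s := (Finset.univ : Finset F)) h
  exact ⟨S, hS⟩

/-! ### Choices of the parameters. -/

namespace RadicalCoordinates

variable {R F : Type*} [Ring R] [Field F] [Fintype F]

theorem exists_arc_two_mul_add (C : RadicalCoordinates R F) {q t : ℕ} (hq : q = Fintype.card F)
    (ht : t + 5 ≤ q) : ∃ K : PHG.Point R → ℕ, PHG.IsProjective K ∧
      PHG.IsArc K (q ^ 3 + (t + 4) * q ^ 2 + (t - 4) * q - 2 * t) (2 * q + t) := by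
  classical
  -- With |W| = c, |Q| = e and |B| = 2, slopes in W give q + 2(c - 1) + e, which is 2q + t exactly
  -- when 2c + e = q + t + 2; e corrects the parity.
  obtain ⟨c, e, he, hce⟩ : ∃ c e, e ≤ 1 ∧ 2 * c + e = q + t + 2 :=
    ⟨(q + t + 2) / 2, (q + t + 2) % 2, by omega, by omega⟩
  -- Column 0 stays empty: a line with γ = 0 may meet U = F × T in q points, any other γ in at most
  -- t. Fitting c + e columns into the other q - 1 uses t ≤ q - 5.
  have h0 : (Finset.univ.erase (0 : F)).card = q - 1 := by
    rw [Finset.card_erase_of_mem (Finset.mem_univ _), Finset.card_univ, hq]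
  obtain ⟨W, hW, hWc⟩ := Finset.exists_subset_card_eq
    (s := Finset.univ.erase (0 : F)) (n := c) (by omega)
  obtain ⟨Q, hQ, hQc⟩ := Finset.exists_subset_card_eq
    (s := Finset.univ.erase (0 : F) \ W) (n := e) (by
      rw [Finset.card_sdiff_of_subset hW]; omega)
  obtain ⟨M, hM, hMc⟩ := Finset.exists_subset_card_eq (s := Wᶜ) (n := 2) (by
      rw [Finset.card_compl]; omega)
  obtain ⟨B, hB⟩ := exists_finset_card_eq (F := F) (n := 2) (by omega)
  obtain ⟨A, hA⟩ := exists_finset_card_eq (F := F) (n := q - 2) (by omega)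
  obtain ⟨T, hT⟩ := exists_finset_card_eq (F := F) (n := t) (by omega)
  have hA' : (A.card : ℤ) = q - 2 := by rw [hA]; omega
  have hWQ : Disjoint W Q := (Finset.sdiff_disjoint.mono_left hQ).symm
  have hWM : Disjoint W M := (disjoint_compl_left.mono_left hM).symm
  have hce' : (2 * c + e : ℤ) = q + t + 2 := by exact_mod_cast hce
  have htq : (t : ℤ) + 5 ≤ q := by exact_mod_cast ht
  refine exists_isArc W Q M B A (Finset.univ ×ˢ T) C hWQ hWM ?_ ?_ ?_ ?_ ?_ ?_
  · nlinarith [mul_nonneg (Int.natCast_nonneg t) (sq_nonneg (q : ℤ)),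
      mul_nonneg (Int.natCast_nonneg q) (by linarith : (0 : ℤ) ≤ q - 5),
      pow_nonneg (Int.natCast_nonneg q) 3,
      mul_nonneg (Int.natCast_nonneg t) (by linarith : (0 : ℤ) ≤ q - 5)]
  -- The construction has 2t points more than required.
  · rw [Finset.card_product, Finset.card_univ, ← hq, hWc, hQc, hMc, hB, hT]
    push_cast
    rw [hA']
    have : (q : ℤ) ^ 2 * (c * 2) + q ^ 2 * e = q ^ 2 * (q + t + 2) := by rw [← hce']; ring
    nlinarith
  · intro μ _
    rw [hWc, hQc, hB, ← hq]
    push_cast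
    linarith
  · intro μ _
    rw [hWc, hQc, hB]
    split_ifs
    · rw [hA']
      push_cast
      linarith
    · push_cast
      linarith
  · intro γ D
    obtain ⟨h1, h2⟩ := card_filter_product_line_le Finset.univ T γ D
    rw [Finset.card_univ, ← hq] at h1
    rw [hT] at h2
    rw [← hq, hB]
    by_cases hγ : γ ∈ W
    · have := h2 (Finset.ne_of_mem_erase (hW hγ))
      rw [if_pos hγ, if_neg (Finset.disjoint_left.1 hWQ hγ)]
      push_cast
      linarith [Nat.cast_le (α := ℤ).2 this]
    · rw [if_neg hγ]
      split_ifs with hγ'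
      · have := h2 (Finset.ne_of_mem_erase (Finset.mem_sdiff.1 (hQ hγ')).1)
        push_cast
        linarith [Nat.cast_le (α := ℤ).2 this]
      · push_cast
        linarith [Nat.cast_le (α := ℤ).2 h1]
  · intro E
    have := card_filter_product_fst_le Finset.univ T E
    rw [hT] at this
    rw [hMc, ← hq]
    push_cast
    linarith [Nat.cast_le (α := ℤ).2 this]

theorem exists_arc_three_mul_sub_four (C : RadicalCoordinates R F) {q : ℕ}
    (hq : q = Fintype.card F) (h4 : 4 ≤ q) : ∃ K : PHG.Point R → ℕ, PHG.IsProjective K ∧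
      PHG.IsArc K (2 * q ^ 3 + q ^ 2 - 12 * q + 16) (3 * q - 4) := by
  classical
  obtain ⟨W, hW⟩ := exists_finset_card_eq (F := F) (n := q - 2) (by omega)
  obtain ⟨B, hB⟩ := exists_finset_card_eq (F := F) (n := 2) (by omega)
  obtain ⟨T, hT⟩ := exists_finset_card_eq (F := F) (n := q - 4) (by omega)
  have hQ : Wᶜ.card = 2 := by rw [Finset.card_compl]; omega
  have hW' : (W.card : ℤ) = q - 2 := by rw [hW]; omega
  have hT' : (T.card : ℤ) = q - 4 := by rw [hT]; omega
  have hq4 : (4 : ℤ) ≤ q := by exact_mod_cast h4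
  -- The second `W` serves as the set of positions A; only its size q - 2 matters.
  refine exists_isArc W Wᶜ Wᶜ B W (T ×ˢ T) C disjoint_compl_right disjoint_compl_right
    ?_ ?_ ?_ ?_ ?_ ?_
  · nlinarith [pow_nonneg (Int.natCast_nonneg q) 3, mul_nonneg (Int.natCast_nonneg q)
      (mul_nonneg (by linarith : (0 : ℤ) ≤ q - 4) (by linarith : (0 : ℤ) ≤ q + 4))]
  · rw [Finset.card_product, ← hq, hQ, hB]
    push_cast
    rw [hW', hT']
    nlinarith
  · intro μ _
    rw [hQ, hB, hW', ← hq]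
    push_cast
    linarith
  · intro μ hμ
    rw [if_pos (Finset.mem_compl.2 hμ), hQ, hB, hW']
    push_cast
    linarith
  · intro γ D
    have h1 := Nat.cast_le (α := ℤ).2 (card_filter_product_line_le T T γ D).1
    rw [hT'] at h1
    rw [← hq, hB]
    by_cases hγ : γ ∈ W
    · rw [if_pos hγ, if_neg (fun h => Finset.mem_compl.1 h hγ)]
      push_cast
      linarith
    · rw [if_neg hγ, if_pos (Finset.mem_compl.2 hγ)]
      push_cast
      linarith
  · intro E
    have := Nat.cast_le (α := ℤ).2 (card_filter_product_fst_le T T E)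
    rw [hT'] at this
    rw [hQ, ← hq]
    push_cast
    linarith

/-- The arcs all of whose affine neighbour classes carry `w` parallel segments. -/
theorem exists_arc_of_parallel_segments (C : RadicalCoordinates R F) {q w m : ℕ}
    (hq : q = Fintype.card F) (hw : w ≤ q) (hm : m ≤ q) {n : ℤ}
    (hn : (q + (q - 1) * w : ℤ) ≤ n) (hn' : (q * w + m : ℤ) ≤ n) :
    ∃ K : PHG.Point R → ℕ, PHG.IsProjective K ∧ PHG.IsArc K (q ^ 3 * w + m * q) n := by
  classical
  obtain ⟨B, hB⟩ := exists_finset_card_eq (F := F) (n := w) (by omega)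
  obtain ⟨T, hT⟩ := exists_finset_card_eq (F := F) (n := m) (by omega)
  refine exists_isArc Finset.univ ∅ ∅ B ∅ (T ×ˢ Finset.univ) C (Finset.disjoint_empty_right _)
    (Finset.disjoint_empty_right _) (by positivity) ?_ ?_ ?_ ?_ ?_
  · rw [Finset.card_product, Finset.card_univ, ← hq, hB, hT]
    simp
    nlinarith
  · intro μ _
    rw [Finset.card_univ, ← hq, hB]
    simpa using hn
  · intro μ hμ
    exact absurd (Finset.mem_univ _) hμ
  · intro γ D
    have h1 := Nat.cast_le (α := ℤ).2 (card_filter_product_line_le T Finset.univ γ D).1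
    rw [hT] at h1
    rw [← hq, hB]
    simp
    linarith
  · intro E
    have := Nat.cast_le (α := ℤ).2 (card_filter_product_fst_le T Finset.univ E)
    rw [Finset.card_univ, ← hq] at this
    have h1 : 1 ≤ q := hq ▸ Fintype.card_pos
    have h2 : (0 : ℤ) ≤ (q - 1) * w :=
      mul_nonneg (by linarith [Nat.cast_le (α := ℤ).2 h1]) (Int.natCast_nonneg w)
    simp
    linarith

theorem exists_arc_three_mul_sub_three (C : RadicalCoordinates R F) {q : ℕ}
    (hq : q = Fintype.card F) : ∃ K : PHG.Point R → ℕ, PHG.IsProjective K ∧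
      PHG.IsArc K (2 * q ^ 3 + q ^ 2 - 5 * q) (3 * q - 3) := by
  classical
  have h2 : 2 ≤ q := hq ▸ Fintype.one_lt_card
  rcases h2.eq_or_lt with h2 | h3
  -- For q = 2 the grid width q - 3 would be negative; one segment per class already gives a (10,
  -- 3)-arc.
  · obtain rfl := h2.symm
    have := C.exists_arc_of_parallel_segments hq (w := 1) (m := 1) (n := 3) (by omega) (by omega)
      (by norm_num) (by norm_num)
    norm_num at this ⊢
    exact this
  obtain ⟨W, hW⟩ := exists_finset_card_eq (F := F) (n := q - 1) (by omega)
  obtain ⟨B, hB⟩ := exists_finset_card_eq (F := F) (n := 2) (by omega)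
  obtain ⟨A, hA⟩ := exists_finset_card_eq (F := F) (n := q - 2) (by omega)
  obtain ⟨T, hT⟩ := exists_finset_card_eq (F := F) (n := q - 3) (by omega)
  have hQ : Wᶜ.card = 1 := by rw [Finset.card_compl]; omega
  have hW' : (W.card : ℤ) = q - 1 := by rw [hW]; omega
  have hA' : (A.card : ℤ) = q - 2 := by rw [hA]; omega
  have hT' : (T.card : ℤ) = q - 3 := by rw [hT]; omega
  have hq3 : (3 : ℤ) ≤ q := by exact_mod_cast h3
  refine exists_isArc W Wᶜ Wᶜ B A (T ×ˢ Finset.univ) C disjoint_compl_right disjoint_compl_right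
    ?_ ?_ ?_ ?_ ?_ ?_
  · nlinarith [pow_nonneg (Int.natCast_nonneg q) 3, mul_nonneg (Int.natCast_nonneg q)
      (mul_nonneg (by linarith : (0 : ℤ) ≤ q - 3) (by linarith : (0 : ℤ) ≤ q + 3))]
  · rw [Finset.card_product, Finset.card_univ, ← hq, hQ, hB]
    push_cast
    rw [hW', hA', hT']
    nlinarith
  · intro μ _
    rw [hQ, hB, hW', ← hq]
    push_cast
    linarith
  · intro μ hμ
    rw [if_pos (Finset.mem_compl.2 hμ), hQ, hB, hW', hA']
    push_cast
    linarith
  · intro γ D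
    have h1 := Nat.cast_le (α := ℤ).2 (card_filter_product_line_le T Finset.univ γ D).1
    rw [hT'] at h1
    rw [← hq, hB]
    by_cases hγ : γ ∈ W
    · rw [if_pos hγ, if_neg (fun h => Finset.mem_compl.1 h hγ)]
      push_cast
      linarith
    · rw [if_neg hγ, if_pos (Finset.mem_compl.2 hγ)]
      push_cast
      linarith
  · intro E
    have := Nat.cast_le (α := ℤ).2 (card_filter_product_fst_le T Finset.univ E)
    rw [Finset.card_univ, ← hq] at this
    rw [hQ, ← hq]
    push_cast
    linarith

theorem exists_arc_three_mul_sub_two (C : RadicalCoordinates R F) {q : ℕ}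
    (hq : q = Fintype.card F) : ∃ K : PHG.Point R → ℕ, PHG.IsProjective K ∧
      PHG.IsArc K (2 * q ^ 3 + q ^ 2 - 2 * q) (3 * q - 2) := by
  have h2 : 2 ≤ q := hq ▸ Fintype.one_lt_card
  have hm : ((q - 2 : ℕ) : ℤ) = q - 2 := by push_cast [Nat.cast_sub h2]; ring
  obtain ⟨K, hK, hK'⟩ := C.exists_arc_of_parallel_segments hq (w := 2) (m := q - 2)
    (n := 3 * q - 2) h2 (by omega) (by push_cast; linarith)
    (by rw [hm]; push_cast; linarith)
  refine ⟨K, hK, ?_⟩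
  rw [hm] at hK'
  convert hK' using 1
  push_cast
  ring

end RadicalCoordinates

/-! ### The four arcs and the bounds on m_n. -/

theorem mainTheorem3 {R : Type*} [Ring R] (hR : IsFiniteChainRingOfLengthTwo R)
    (q : ℕ) (hq : q = residueOrder R) :
    (∀ t : ℕ, t + 5 ≤ q → ∃ K : PHG.Point R → ℕ, PHG.IsProjective K ∧
      PHG.IsArc K (q ^ 3 + (t + 4) * q ^ 2 + (t - 4) * q - 2 * t) (2 * q + t)) ∧
    (4 ≤ q → ∃ K : PHG.Point R → ℕ, PHG.IsProjective K ∧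
      PHG.IsArc K (2 * q ^ 3 + q ^ 2 - 12 * q + 16) (3 * q - 4)) ∧
    (∃ K : PHG.Point R → ℕ, PHG.IsProjective K ∧
      PHG.IsArc K (2 * q ^ 3 + q ^ 2 - 5 * q) (3 * q - 3)) ∧
    (∃ K : PHG.Point R → ℕ, PHG.IsProjective K ∧
      PHG.IsArc K (2 * q ^ 3 + q ^ 2 - 2 * q) (3 * q - 2)) ∧
    (∀ n t : ℕ, n = 2 * q + t → t + 2 ≤ q →
      (t + 5 ≤ q →
        (PHG.maxArcSize R n : ℤ) ≥ q * (q + 1) * n - q ^ 3 + 2 * q ^ 2 - 4 * q - 2 * t) ∧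
      (t + 4 = q →
        (PHG.maxArcSize R n : ℤ) ≥ q * (q + 1) * n - q ^ 3 + 2 * q ^ 2 - 8 * q + 16) ∧
      (t + 3 = q →
        (PHG.maxArcSize R n : ℤ) ≥ q * (q + 1) * n - q ^ 3 + q ^ 2 - 2 * q) ∧
      (t + 2 = q →
        (PHG.maxArcSize R n : ℤ) ≥ q * (q + 1) * n - q ^ 3)) := by

  classical
  have := hR.finite
  have hfin : Finite (R ⧸ Ring.jacobson R) := Finite.of_surjective _ Ideal.Quotient.mk_surjective
  let _ : Field (R ⧸ Ring.jacobson R) := hR.isField_quotient.toField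
  let _ : Fintype (R ⧸ Ring.jacobson R) := Fintype.ofFinite _
  obtain ⟨C⟩ := hR.exists_radicalCoordinates (Ideal.Quotient.mk (Ring.jacobson R))
    Ideal.Quotient.mk_surjective fun r => Ideal.Quotient.eq_zero_iff_mem
  have hq' : q = Fintype.card (R ⧸ Ring.jacobson R) := by
    rw [hq, residueOrder, Nat.card_eq_fintype_card]
  have h2 : 2 ≤ q := hq' ▸ Fintype.one_lt_card
  have hq2 : (2 : ℤ) ≤ q := by exact_mod_cast h2
  have harc1 := fun t ht => C.exists_arc_two_mul_add (t := t) hq' ht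
  have harc2 := C.exists_arc_three_mul_sub_four hq'
  have harc3 := C.exists_arc_three_mul_sub_three hq'
  have harc4 := C.exists_arc_three_mul_sub_two hq'
  have hsize : ∀ {k k' n' : ℤ} {n : ℕ}, (∃ K : PHG.Point R → ℕ, PHG.IsProjective K ∧
      PHG.IsArc K k n') → n' = n → k' = k → (PHG.maxArcSize R n : ℤ) ≥ k' := by
    rintro k k' n' n ⟨K, hK, hK'⟩ rfl rfl
    exact PHG.le_maxArcSize (hK'.1 ▸ Int.natCast_nonneg _) ⟨K, hK, hK'⟩
  refine ⟨harc1, harc2, harc3, harc4, ?_⟩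
  rintro n t rfl -
  refine ⟨fun ht => hsize (harc1 t ht) (by push_cast; ring) (by push_cast; ring),
    fun ht => hsize (harc2 (by omega)) ?_ ?_, fun ht => hsize harc3 ?_ ?_,
    fun ht => hsize harc4 ?_ ?_⟩ <;>
  · subst ht
    push_cast
    ring
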